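/- Throughout, complex manifolds are Hausdorff, second countable and of pure (finite) dimension, connected spaces are nonempty, and complex submanifolds are embedded but not necessarily closed. Theorem 1.2. Let $M_0$ be a complex manifold and let $S$ be a connected $n$-dimensional complex submanifold of $M_0$. Then there exists a leaf extension of $S$ in $M_0$, that is, a connected $n$-dimensional complex manifold $M$ together with a holomorphic immersion $\phi: M\to M_0$ such that $\phi(M)\supset S$ and such that the following universal property is satisfied: for every connected $n$-dimensional complex manifold $M_1$ and every holomorphic immersion $\phi_1: M_1\to M_0$ such that $\phi_1(U_1)\subset\phi(M)$ for some nonempty open subset $U_1$ of $M_1$, there is a unique holomorphic map $\rho_{\phi_1}: M_1\to M$ with $\phi_1=\phi\circ\rho_{\phi_1}$. -/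

import Mathlib

open scoped Manifold ContDiff

universe u v w

/-- The model space `ℂⁿ` of `n`-dimensional complex manifolds. -/
abbrev CSpace (n : ℕ) : Type := EuclideanSpace ℂ (Fin n)

/-- `M`, with its given topology and charts, is an `n`-dimensional complex manifold: it is Hausdorff
and second countable, and the changes of charts are holomorphic (`ω` means analytic, here over `ℂ`).
Connectedness is not included. -/
structure IsComplexManifold (n : ℕ) (M : Type*) [TopologicalSpace M]
    [ChartedSpace (CSpace n) M] : Prop where
  t2 : T2Space M
  secondCountable : SecondCountableTopology M
  isManifold : IsManifold 𝓘(ℂ, CSpace n) ω M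

/-- Holomorphic maps from an `m`-dimensional to an `n`-dimensional complex manifold. -/
def IsHolomorphic (m n : ℕ) {M N : Type*} [TopologicalSpace M] [ChartedSpace (CSpace m) M]
    [TopologicalSpace N] [ChartedSpace (CSpace n) N] (f : M → N) : Prop :=
  ContMDiff 𝓘(ℂ, CSpace m) 𝓘(ℂ, CSpace n) ω f

/-- Holomorphic immersions: in suitable holomorphic charts around `x` and `f x`, the map `f` is
`u ↦ (u, 0)`. Such a map is holomorphic (`Manifold.IsImmersion.contMDiff`). -/
def IsHolomorphicImmersion (m n : ℕ) {M N : Type*} [TopologicalSpace M]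
    [ChartedSpace (CSpace m) M] [TopologicalSpace N] [ChartedSpace (CSpace n) N]
    (f : M → N) : Prop :=
  Manifold.IsImmersion 𝓘(ℂ, CSpace m) 𝓘(ℂ, CSpace n) ω f

/-- `S` is an `n`-dimensional complex (embedded, not necessarily closed) submanifold of the
`N`-dimensional complex manifold `M₀`: around each of its points there is a holomorphic chart `e`
of `M₀` in which `S` is an `n`-dimensional complex linear subspace `L` of `ℂᴺ`, that is,
`q ∈ S ↔ e q ∈ L` for all `q` in the domain of `e`. -/
def IsComplexSubmanifold (N n : ℕ) {M₀ : Type*} [TopologicalSpace M₀]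
    [ChartedSpace (CSpace N) M₀] (S : Set M₀) : Prop :=
  ∀ p ∈ S, ∃ e ∈ IsManifold.maximalAtlas 𝓘(ℂ, CSpace N) ω M₀, p ∈ e.source ∧
    ∃ L : Submodule ℂ (CSpace N), Module.finrank ℂ L = n ∧ ∀ q ∈ e.source, q ∈ S ↔ e q ∈ L

/-- `(M, φ)` is an `n`-dimensional complex leaf pair of the `N`-dimensional complex manifold `M₀`.
The universe `w` of the test manifolds `M₁` is arbitrary. -/
structure IsComplexLeafPair (N n : ℕ) {M₀ : Type u} [TopologicalSpace M₀]
    [ChartedSpace (CSpace N) M₀] (M : Type v) [TopologicalSpace M] [ChartedSpace (CSpace n) M]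
    (φ : M → M₀) : Prop where
  isComplexManifold : IsComplexManifold n M
  connected : ConnectedSpace M
  isImmersion : IsHolomorphicImmersion n N φ
  universal : ∀ (M₁ : Type w) [TopologicalSpace M₁] [ChartedSpace (CSpace n) M₁],
    IsComplexManifold n M₁ → ConnectedSpace M₁ →
    ∀ φ₁ : M₁ → M₀, IsHolomorphicImmersion n N φ₁ →
      (∃ U₁ : Set M₁, IsOpen U₁ ∧ U₁.Nonempty ∧ φ₁ '' U₁ ⊆ Set.range φ) →
      ∃! ρ : M₁ → M, IsHolomorphic n n ρ ∧ φ₁ = φ ∘ ρ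

/-- `(M, φ)` is a leaf extension in `M₀` of the `n`-dimensional submanifold `S`. -/
structure IsLeafExtension (N n : ℕ) {M₀ : Type u} [TopologicalSpace M₀]
    [ChartedSpace (CSpace N) M₀] (S : Set M₀) (M : Type v) [TopologicalSpace M]
    [ChartedSpace (CSpace n) M] (φ : M → M₀) : Prop where
  isLeafPair : IsComplexLeafPair.{u, v, w} N n M φ
  subset_range : S ⊆ Set.range φ

open Set Filter Topology

/-!
The leaf is built from germs. A *slice* of `M₀` is the part of a chart domain on which the
transverse coordinates vanish, and the germs of all slices at all points of `M₀` form an analytic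
manifold: the coordinates along a slice are a chart on the germs of that slice. By the identity
theorem, two slices whose germs agree at points accumulating at a common point have the same germ
there, so the space of germs is Hausdorff, and it is immersed in `M₀` by sending a germ to its
point.

A submanifold, or more generally an immersed manifold, lifts canonically to the space of germs,
and the lift is the only continuous one. The leaf `M` is the connected component containing the
lift of `S`; it is second countable by the Poincaré–Volterra theorem. If an immersion
`φ₁ : M₁ → M₀` maps a nonempty open set into the image of `M`, then, `M` being a countable union
of compact pieces of slices, Baire's theorem yields an open set mapped by `φ₁` into a single such
piece. There the lift of `φ₁` lies in `M`, hence it does so on all of the connected space `M₁`.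
-/

/-! ### Locally injective maps -/

theorem countable_setOf_transGen {ι : Type*} {r : ι → ι → Prop} (hr : ∀ i, {j | r i j}.Countable)
    (i : ι) : {j | Relation.TransGen r i j}.Countable := by
  let reach : ℕ → Set ι := fun k ↦ (fun s ↦ ⋃ a ∈ s, {b | r a b})^[k] {i}
  have reach_succ (k : ℕ) : reach (k + 1) = ⋃ a ∈ reach k, {b | r a b} :=
    Function.iterate_succ_apply' _ _ _
  have countable_reach (k : ℕ) : (reach k).Countable := by
    induction k with
    | zero => exact countable_singleton i
    | succ k ih => exact reach_succ k ▸ ih.biUnion fun a _ ↦ hr a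
  have mem_reach_succ {k : ℕ} {a b : ι} (ha : a ∈ reach k) (hab : r a b) : b ∈ reach (k + 1) :=
    reach_succ k ▸ mem_biUnion ha hab
  refine (countable_iUnion countable_reach).mono fun j hj ↦ mem_iUnion.2 ?_
  induction hj with
  | single h => exact ⟨1, mem_reach_succ (k := 0) rfl h⟩
  | tail _ h ih => exact ih.elim fun k hk ↦ ⟨k + 1, mem_reach_succ hk h⟩

theorem countable_of_countable_setOf_inter_nonempty {X ι : Type*} [TopologicalSpace X]
    [PreconnectedSpace X] {s : ι → Set X} (hopen : ∀ i, IsOpen (s i))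
    (hne : ∀ i, (s i).Nonempty) (hcover : ⋃ i, s i = univ)
    (hmeet : ∀ i, {j | (s i ∩ s j).Nonempty}.Countable) : Countable ι := by
  rcases isEmpty_or_nonempty ι with _ | ⟨⟨i⟩⟩
  · infer_instance
  have hconn : IsPreconnected (⋃ i, s i) := hcover ▸ isPreconnected_univ
  exact countable_univ_iff.1 <| (countable_setOf_transGen hmeet i).mono fun j _ ↦
    hconn.transGen_of_iUnion hopen i j (hne i) (hne j)

theorem countable_setOf_connectedComponentIn_inter_nonempty {X : Type*} [TopologicalSpace X]
    [LocallyConnectedSpace X] {F : Set X} (hF : IsOpen F) (V : Set X)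
    [TopologicalSpace.SeparableSpace V] :
    {W | (∃ x ∈ F, W = connectedComponentIn F x) ∧ (V ∩ W).Nonempty}.Countable := by
  refine PairwiseDisjoint.countable_of_isOpen (s := fun W ↦ (Subtype.val ⁻¹' W : Set V)) ?_ ?_ ?_
  · rintro _ ⟨⟨x, -, rfl⟩, -⟩ _ ⟨⟨y, -, rfl⟩, -⟩ hne
    refine Disjoint.preimage _ (disjoint_left.2 fun z hzx hzy ↦ hne ?_)
    exact (connectedComponentIn_eq hzx).trans (connectedComponentIn_eq hzy).symm
  · rintro _ ⟨⟨x, -, rfl⟩, -⟩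
    exact hF.connectedComponentIn.preimage continuous_subtype_val
  · rintro W ⟨-, z, hzV, hzW⟩
    exact ⟨⟨z, hzV⟩, hzW⟩

theorem exists_mem_basis_connectedComponentIn_preimage_subset {X Y : Type*} [TopologicalSpace X]
    [TopologicalSpace Y] [T2Space X] [LocallyCompactSpace X] [T2Space Y] {f : X → Y}
    (hf : Continuous f) {B : Set (Set Y)} (hB : TopologicalSpace.IsTopologicalBasis B) {x : X}
    {O : Set X} (hO : O ∈ 𝓝 x) (hinj : InjOn f O) :
    ∃ U ∈ B, f x ∈ U ∧ connectedComponentIn (f ⁻¹' U) x ⊆ O := by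
  obtain ⟨K, hK, hKO, hKc⟩ := local_compact_nhds hO
  have hxK : x ∈ interior K := mem_interior_iff_mem_nhds.2 hK
  have hclosed : IsClosed (f '' (K \ interior K)) :=
    ((hKc.diff isOpen_interior).image hf).isClosed
  have hfx : f x ∈ (f '' (K \ interior K))ᶜ := by
    rintro ⟨y, ⟨hyK, hyi⟩, hy⟩
    exact hyi (hinj (hKO hyK) (hKO (interior_subset hxK)) hy ▸ hxK)
  obtain ⟨U, hU, hxU, hUs⟩ := hB.exists_subset_of_mem_open hfx hclosed.isOpen_compl
  have hsub : connectedComponentIn (f ⁻¹' U) x ⊆ interior K ∪ Kᶜ := by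
    intro y hy
    by_contra h
    rw [mem_union, not_or, mem_compl_iff, not_not] at h
    exact hUs (connectedComponentIn_subset (f ⁻¹' U) x hy) ⟨y, h.symm, rfl⟩
  refine ⟨U, hU, hxU, ?_⟩
  calc connectedComponentIn (f ⁻¹' U) x ⊆ interior K :=
        isPreconnected_connectedComponentIn.subset_left_of_subset_union isOpen_interior
          hKc.isClosed.isOpen_compl (disjoint_compl_right.mono_left interior_subset) hsub
          ⟨x, mem_connectedComponentIn hxU, hxK⟩
    _ ⊆ O := interior_subset.trans hKO

/-- The **Poincaré–Volterra theorem**. -/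
theorem secondCountableTopology_of_locally_injective {X Y : Type*} [TopologicalSpace X]
    [TopologicalSpace Y] [T2Space X] [LocallyCompactSpace X] [LocallyConnectedSpace X]
    [PreconnectedSpace X] [T2Space Y] [SecondCountableTopology Y] {f : X → Y}
    (hf : Continuous f) (hloc : ∀ x, ∃ O ∈ 𝓝 x, SecondCountableTopology O ∧ InjOn f O) :
    SecondCountableTopology X := by
  let B := TopologicalSpace.countableBasis Y
  have hB : TopologicalSpace.IsTopologicalBasis B := TopologicalSpace.isBasis_countableBasis Y
  let 𝒞 (U : Set Y) : Set (Set X) := {W | ∃ x ∈ f ⁻¹' U, W = connectedComponentIn (f ⁻¹' U) x}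
  let 𝒱 : Set (Set X) := {V | SecondCountableTopology V ∧ ∃ U ∈ B, V ∈ 𝒞 U}
  have hopen (V : 𝒱) : IsOpen (V : Set X) := by
    obtain ⟨_, -, U, hU, x, -, rfl⟩ := V
    exact ((hB.isOpen hU).preimage hf).connectedComponentIn
  have hne (V : 𝒱) : (V : Set X).Nonempty := by
    obtain ⟨_, -, U, -, x, hx, rfl⟩ := V
    exact ⟨x, mem_connectedComponentIn hx⟩
  have hcover : ⋃ V : 𝒱, (V : Set X) = univ := by
    refine eq_univ_of_forall fun x ↦ ?_
    obtain ⟨O, hO, hOc, hinj⟩ := hloc x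
    obtain ⟨U, hU, hxU, hUO⟩ :=
      exists_mem_basis_connectedComponentIn_preimage_subset hf hB hO hinj
    exact mem_iUnion.2 ⟨⟨_, (IsEmbedding.inclusion hUO).secondCountableTopology,
      U, hU, x, hxU, rfl⟩, mem_connectedComponentIn hxU⟩
  have hmeet (V : 𝒱) : {W : 𝒱 | ((V : Set X) ∩ W).Nonempty}.Countable := by
    have := V.2.1
    have hB' : (⋃ U ∈ B, {W | W ∈ 𝒞 U ∧ ((V : Set X) ∩ W).Nonempty}).Countable :=
      (TopologicalSpace.countable_countableBasis Y).biUnion fun U hU ↦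
        countable_setOf_connectedComponentIn_inter_nonempty ((hB.isOpen hU).preimage hf) V
    refine (hB'.preimage Subtype.val_injective).mono ?_
    rintro ⟨W, _, U, hU, hW⟩ hVW
    exact mem_iUnion₂.2 ⟨U, hU, hW, hVW⟩
  have := countable_of_countable_setOf_inter_nonempty hopen hne hcover hmeet
  have (V : 𝒱) : SecondCountableTopology (V : Set X) := V.2.1
  exact TopologicalSpace.secondCountableTopology_of_countable_cover hopen hcover

/-! ### Baire spaces and local inverses -/

theorem baireSpace_of_chartedSpace (H : Type*) [TopologicalSpace H] [BaireSpace H] (M : Type*)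
    [TopologicalSpace M] [ChartedSpace H M] : BaireSpace M := by
  refine ⟨fun f hopen hdense x ↦ ?_⟩
  let e := chartAt H x
  have := e.open_target.baireSpace
  have : BaireSpace e.source := e.toHomeomorphSourceTarget.symm.baireSpace
  have h : Dense (⋂ n, (Subtype.val ⁻¹' f n : Set e.source)) :=
    dense_iInter_of_isOpen_nat (fun n ↦ (hopen n).preimage continuous_subtype_val)
      fun n ↦ (hdense n).preimage e.open_source.isOpenMap_subtype_val
  have hx : x ∈ closure (Subtype.val '' ⋂ n, (Subtype.val ⁻¹' f n : Set e.source)) :=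
    closure_subtype.1 (h ⟨x, mem_chart_source H x⟩)
  refine closure_mono ?_ hx
  rw [← preimage_iInter]
  exact image_preimage_subset _ _

theorem exists_nonempty_interior_of_subset_iUnion {X ι : Type*} [TopologicalSpace X] [BaireSpace X]
    [Countable ι] {U : Set X} (hU : IsOpen U) (hne : U.Nonempty) {K : ι → Set X}
    (hK : ∀ i, IsClosed (K i)) (hsub : U ⊆ ⋃ i, K i) : ∃ i, (interior (K i)).Nonempty := by
  by_contra! h
  exact not_isMeagre_of_isOpen hU hne <|
    (isMeagre_iUnion fun i ↦ ((hK i).isNowhereDense_iff.2 (h i)).isMeagre).mono hsub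

theorem map_nhds_eq_of_leftInverse {𝕜 E : Type*} [NontriviallyNormedField 𝕜] [CompleteSpace 𝕜]
    [NormedAddCommGroup E] [NormedSpace 𝕜 E] [FiniteDimensional 𝕜 E] {h k : E → E}
    {h' : E →L[𝕜] E} {x : E}
    (hh : HasStrictFDerivAt h h' x) (hk : DifferentiableAt 𝕜 k (h x)) (hkh : k ∘ h =ᶠ[𝓝 x] id) :
    map h (𝓝 x) = 𝓝 (h x) := by
  have := FiniteDimensional.complete 𝕜 E
  have hcomp : (fderiv 𝕜 k (h x)).comp h' = ContinuousLinearMap.id 𝕜 E := by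
    rw [← (hk.hasFDerivAt.comp x hh.hasFDerivAt).fderiv, hkh.fderiv_eq, fderiv_id]
  have hinj : Function.Injective h' := Function.LeftInverse.injective (DFunLike.congr_fun hcomp)
  exact hh.map_nhds_eq_of_surj
    (LinearMap.range_eq_top.2 (LinearMap.injective_iff_surjective.1 hinj))

/-! ### Slices -/

variable {𝕜 E C F : Type*} [NontriviallyNormedField 𝕜] [NormedAddCommGroup E] [NormedSpace 𝕜 E]
  [NormedAddCommGroup C] [NormedSpace 𝕜 C] [NormedAddCommGroup F] [NormedSpace 𝕜 F]
  {M₀ : Type u} [TopologicalSpace M₀] [ChartedSpace F M₀]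

variable (𝕜 E C F M₀) in
/-- A chart of `M₀` together with a splitting `E × C ≃ F` of its model space. It cuts out the slice
of `M₀` on which the `C`-coordinate vanishes; the field `base` only records that this slice is
nonempty. -/
structure SliceChart where
  chart : OpenPartialHomeomorph M₀ F
  chart_mem : chart ∈ IsManifold.maximalAtlas 𝓘(𝕜, F) ω M₀
  split : (E × C) ≃L[𝕜] F
  base : E
  base_mem : split (base, 0) ∈ chart.target

namespace SliceChart

variable (d d' : SliceChart 𝕜 E C F M₀)

/-- The coordinate along the slice. -/
def coord (q : M₀) : E := (d.split.symm (d.chart q)).1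

/-- The coordinate transverse to the slice. -/
def normal (q : M₀) : C := (d.split.symm (d.chart q)).2

/-- The slice cut out by a slice chart. -/
def slice : Set M₀ := {q | q ∈ d.chart.source ∧ d.normal q = 0}

/-- The parametrization of the slice, inverse to `SliceChart.coord`. -/
def param (v : E) : M₀ := d.chart.symm (d.split (v, 0))

/-- The domain of the parametrization of the slice. -/
def dom : Set E := {v | d.split (v, 0) ∈ d.chart.target}

theorem isOpen_dom : IsOpen d.dom :=
  d.chart.open_target.preimage (by fun_prop : Continuous fun v : E ↦ d.split (v, 0))

theorem chart_param {v : E} (hv : v ∈ d.dom) : d.chart (d.param v) = d.split (v, 0) :=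
  d.chart.right_inv hv

theorem coord_param {v : E} (hv : v ∈ d.dom) : d.coord (d.param v) = v := by
  simp only [coord, d.chart_param hv, ContinuousLinearEquiv.symm_apply_apply]

theorem param_mem_slice {v : E} (hv : v ∈ d.dom) : d.param v ∈ d.slice :=
  ⟨d.chart.map_target hv, by
    simp only [normal, d.chart_param hv, ContinuousLinearEquiv.symm_apply_apply]⟩

variable {d} in
theorem split_coord {q : M₀} (hq : q ∈ d.slice) : d.split (d.coord q, 0) = d.chart q := by
  rw [← hq.2]
  exact d.split.apply_symm_apply _

theorem coord_mem_dom {q : M₀} (hq : q ∈ d.slice) : d.coord q ∈ d.dom := by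
  rw [dom, mem_ofPred_eq, split_coord hq]
  exact d.chart.map_source hq.1

theorem param_coord {q : M₀} (hq : q ∈ d.slice) : d.param (d.coord q) = q := by
  rw [param, split_coord hq, d.chart.left_inv hq.1]

theorem contMDiffAt_coord {q : M₀} (hq : q ∈ d.chart.source) :
    ContMDiffAt 𝓘(𝕜, F) 𝓘(𝕜, E) ω d.coord q :=
  ((ContinuousLinearMap.fst 𝕜 E C).comp d.split.symm.toContinuousLinearMap).contMDiffAt.comp q
    (contMDiffAt_of_mem_maximalAtlas d.chart_mem hq)

theorem contMDiffAt_normal {q : M₀} (hq : q ∈ d.chart.source) :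
    ContMDiffAt 𝓘(𝕜, F) 𝓘(𝕜, C) ω d.normal q :=
  ((ContinuousLinearMap.snd 𝕜 E C).comp d.split.symm.toContinuousLinearMap).contMDiffAt.comp q
    (contMDiffAt_of_mem_maximalAtlas d.chart_mem hq)

theorem contMDiffAt_param {v : E} (hv : v ∈ d.dom) :
    ContMDiffAt 𝓘(𝕜, E) 𝓘(𝕜, F) ω d.param v :=
  (contMDiffAt_symm_of_mem_maximalAtlas d.chart_mem hv).comp v
    (d.split.toContinuousLinearMap.comp (ContinuousLinearMap.inl 𝕜 E C)).contMDiffAt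

theorem map_param_nhds {v : E} (hv : v ∈ d.dom) :
    map d.param (𝓝 v) = 𝓝[d.slice] (d.param v) := by
  have hmem : ∀ᶠ w in 𝓝 v, d.param w ∈ d.slice := by
    filter_upwards [d.isOpen_dom.mem_nhds hv] with w hw using d.param_mem_slice hw
  have hcoord : Tendsto d.coord (𝓝[d.slice] (d.param v)) (𝓝 v) := by
    have := (d.contMDiffAt_coord (d.param_mem_slice hv).1).continuousAt.continuousWithinAt
      (s := d.slice)
    rwa [ContinuousWithinAt, d.coord_param hv] at this
  refine le_antisymm
    (tendsto_nhdsWithin_iff.2 ⟨(d.contMDiffAt_param hv).continuousAt, hmem⟩) ?_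
  calc 𝓝[d.slice] (d.param v) = map (d.param ∘ d.coord) (𝓝[d.slice] (d.param v)) :=
        (map_id.symm.trans <| map_congr <| eventually_mem_nhdsWithin.mono fun q hq ↦
          (d.param_coord hq).symm)
    _ = map d.param (map d.coord (𝓝[d.slice] (d.param v))) := map_map.symm
    _ ≤ map d.param (𝓝 v) := map_mono hcoord

theorem map_param_nhds_coord {q : M₀} (hq : q ∈ d.slice) :
    map d.param (𝓝 (d.coord q)) = 𝓝[d.slice] q := by
  rw [d.map_param_nhds (d.coord_mem_dom hq), d.param_coord hq]

theorem contDiffAt_coord_param {v : E} (hv : v ∈ d.dom) (h : d.param v ∈ d'.chart.source) :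
    ContDiffAt 𝕜 ω (d'.coord ∘ d.param) v :=
  ((d'.contMDiffAt_coord h).comp v (d.contMDiffAt_param hv)).contDiffAt

theorem contDiffAt_normal_param {v : E} (hv : v ∈ d.dom) (h : d.param v ∈ d'.chart.source) :
    ContDiffAt 𝕜 ω (d'.normal ∘ d.param) v :=
  ((d'.contMDiffAt_normal h).comp v (d.contMDiffAt_param hv)).contDiffAt

theorem nhdsWithin_slice_eq_of_le [CompleteSpace 𝕜] [FiniteDimensional 𝕜 E] {p : M₀}
    (hp : p ∈ d.slice) (hp' : p ∈ d'.slice) (hle : 𝓝[d.slice] p ≤ 𝓝[d'.slice] p) :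
    𝓝[d.slice] p = 𝓝[d'.slice] p := by
  have hmem : ∀ᶠ w in 𝓝 (d.coord p), d.param w ∈ d'.slice := by
    have := hle self_mem_nhdsWithin
    rwa [← d.map_param_nhds_coord hp] at this
  have hcoord : (d'.coord ∘ d.param) (d.coord p) = d'.coord p :=
    congrArg d'.coord (d.param_coord hp)
  have hinv : (d.coord ∘ d'.param) ∘ (d'.coord ∘ d.param) =ᶠ[𝓝 (d.coord p)] id := by
    filter_upwards [hmem, d.isOpen_dom.mem_nhds (d.coord_mem_dom hp)] with w hw hw'
    simp only [Function.comp_apply, id, d'.param_coord hw, d.coord_param hw']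
  have htrans : ContDiffAt 𝕜 ω (d'.coord ∘ d.param) (d.coord p) :=
    d.contDiffAt_coord_param d' (d.coord_mem_dom hp) (by rw [d.param_coord hp]; exact hp'.1)
  have htrans' : ContDiffAt 𝕜 ω (d.coord ∘ d'.param) (d'.coord p) :=
    d'.contDiffAt_coord_param d (d'.coord_mem_dom hp') (by rw [d'.param_coord hp']; exact hp.1)
  have hmap : map (d'.coord ∘ d.param) (𝓝 (d.coord p)) = 𝓝 (d'.coord p) := by
    rw [← hcoord]
    exact map_nhds_eq_of_leftInverse htrans.analyticAt.hasStrictFDerivAt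
      (by rw [hcoord]; exact htrans'.analyticAt.differentiableAt) hinv
  calc 𝓝[d.slice] p = map d.param (𝓝 (d.coord p)) := (d.map_param_nhds_coord hp).symm
    _ = map (d'.param ∘ d'.coord ∘ d.param) (𝓝 (d.coord p)) :=
        map_congr <| hmem.mono fun w hw ↦ (d'.param_coord hw).symm
    _ = map d'.param (𝓝 (d'.coord p)) := by rw [← map_map, hmap]
    _ = 𝓝[d'.slice] p := d'.map_param_nhds_coord hp'

/-- The identity theorem for slices. -/
theorem mapsTo_param_slice_of_isPreconnected {B : Set E} (hB : IsPreconnected B)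
    (hdom : B ⊆ d.dom) (hsource : MapsTo d.param B d'.chart.source) {v : E} (hv : v ∈ B)
    (hle : 𝓝[d.slice] (d.param v) ≤ 𝓝[d'.slice] (d.param v)) : MapsTo d.param B d'.slice := by
  have hanalytic : AnalyticOnNhd 𝕜 (d'.normal ∘ d.param) B := fun w hw ↦
    (d.contDiffAt_normal_param d' (hdom hw) (hsource hw)).analyticAt
  have hzero : d'.normal ∘ d.param =ᶠ[𝓝 v] 0 := by
    have hmem : ∀ᶠ q in 𝓝[d.slice] (d.param v), q ∈ d'.slice := hle self_mem_nhdsWithin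
    rw [← d.map_param_nhds (hdom hv), eventually_map] at hmem
    exact hmem.mono fun w hw ↦ hw.2
  exact fun w hw ↦ ⟨hsource hw,
    hanalytic.eqOn_zero_of_preconnected_of_eventuallyEq_zero hB hv hzero hw⟩

theorem nhdsWithin_slice_le_of_frequently [LocallyConnectedSpace E] {p : M₀} (hp : p ∈ d.slice)
    (hp' : p ∈ d'.chart.source)
    (h : ∃ᶠ q in 𝓝[d.slice] p, 𝓝[d.slice] q ≤ 𝓝[d'.slice] q) :
    𝓝[d.slice] p ≤ 𝓝[d'.slice] p := by
  let O : Set E := d.dom ∩ d.param ⁻¹' d'.chart.source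
  have hO : O ∈ 𝓝 (d.coord p) := by
    refine inter_mem (d.isOpen_dom.mem_nhds (d.coord_mem_dom hp))
      ((d.contMDiffAt_param (d.coord_mem_dom hp)).continuousAt.preimage_mem_nhds ?_)
    rw [d.param_coord hp]
    exact d'.chart.open_source.mem_nhds hp'
  let B := connectedComponentIn O (d.coord p)
  have hB : B ∈ 𝓝 (d.coord p) := connectedComponentIn_mem_nhds hO
  have hBO : B ⊆ O := connectedComponentIn_subset O _
  rw [← d.map_param_nhds_coord hp, frequently_map] at h
  obtain ⟨v, hle, hv⟩ := (h.and_eventually hB).exists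
  have hmaps : MapsTo d.param B d'.slice := d.mapsTo_param_slice_of_isPreconnected d'
    isPreconnected_connectedComponentIn (fun w hw ↦ (hBO hw).1) (fun w hw ↦ (hBO hw).2) hv hle
  refine le_inf nhdsWithin_le_nhds (le_principal_iff.2 ?_)
  rw [← d.map_param_nhds_coord hp]
  exact mem_map.2 (mem_of_superset hB hmaps)

section Adapted

variable {M : Type*} [TopologicalSpace M] {c : OpenPartialHomeomorph M E} {φ : M → M₀}

/-- The chart `c` of `M` is the `φ`-pullback of the coordinate of a slice. -/
def IsAdapted (c : OpenPartialHomeomorph M E) (φ : M → M₀) : Prop :=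
  ∀ y ∈ c.source, φ y ∈ d.slice ∧ d.coord (φ y) = c y

variable {d}

theorem IsAdapted.injOn (h : d.IsAdapted c φ) : InjOn φ c.source := fun y hy z hz hyz ↦
  c.injOn hy hz (by rw [← (h y hy).2, ← (h z hz).2, hyz])

theorem IsAdapted.map_nhds (h : d.IsAdapted c φ) {y : M} (hy : y ∈ c.source) :
    map φ (𝓝 y) = 𝓝[d.slice] (φ y) := by
  have hφ : φ =ᶠ[𝓝 y] d.param ∘ c := by
    filter_upwards [c.open_source.mem_nhds hy] with z hz
    rw [Function.comp_apply, ← (h z hz).2, d.param_coord (h z hz).1]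
  rw [map_congr hφ, ← map_map, c.map_nhds_eq hy, ← (h y hy).2,
    d.map_param_nhds_coord (h y hy).1]

variable [ChartedSpace E M]

theorem IsAdapted.isImmersionAtOfComplement (h : d.IsAdapted c φ)
    (hc : c ∈ IsManifold.maximalAtlas 𝓘(𝕜, E) ω M) {x : M} (hx : x ∈ c.source) :
    Manifold.IsImmersionAtOfComplement C 𝓘(𝕜, E) 𝓘(𝕜, F) ω φ x := by
  refine .mk_of_charts d.split c d.chart hx (h x hx).1.1 hc d.chart_mem
    (fun y hy ↦ (h y hy).1.1) fun v hv ↦ ?_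
  have hv : v ∈ c.target := by simpa using hv
  obtain ⟨hmem, hcoord⟩ := h _ (c.map_target hv)
  have : d.chart (φ (c.symm v)) = d.split (v, 0) := by
    rw [← split_coord hmem, hcoord, c.right_inv hv]
  simpa using this

theorem exists_isAdapted {x : M}
    (h : Manifold.IsImmersionAtOfComplement C 𝓘(𝕜, E) 𝓘(𝕜, F) ω φ x) :
    ∃ (d : SliceChart 𝕜 E C F M₀) (c : OpenPartialHomeomorph M E),
      x ∈ c.source ∧ d.IsAdapted c φ := by
  have hchart : ∀ y ∈ h.domChart.source, h.codChart (φ y) = h.equiv (h.domChart y, 0) := by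
    intro y hy
    have hy' : h.domChart y ∈ (h.domChart.extend 𝓘(𝕜, E)).target := by
      simpa using h.domChart.map_source hy
    simpa [h.domChart.left_inv hy] using h.writtenInCharts hy'
  refine ⟨⟨h.codChart, h.codChart_mem_maximalAtlas, h.equiv, h.domChart x, ?_⟩, h.domChart,
    h.mem_domChart_source, fun y hy ↦ ⟨⟨h.source_subset_preimage_source hy, ?_⟩, ?_⟩⟩
  · rw [← hchart x h.mem_domChart_source]
    exact h.codChart.map_source h.mem_codChart_source
  · simp [normal, hchart y hy]
  · simp [coord, hchart y hy]

end Adapted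

end SliceChart

theorem secondCountableTopology_of_isImmersionOfComplement {M : Type*} [TopologicalSpace M]
    [ChartedSpace E M] {φ : M → M₀} [ProperSpace E]
    [LocallyConnectedSpace E] [T2Space M₀] [SecondCountableTopology M₀] [T2Space M]
    [PreconnectedSpace M]
    (hφ : Manifold.IsImmersionOfComplement C 𝓘(𝕜, E) 𝓘(𝕜, F) ω φ) : SecondCountableTopology M := by
  have := ChartedSpace.locallyCompactSpace E M
  have := ChartedSpace.locallyConnectedSpace E M
  refine secondCountableTopology_of_locally_injective
    (continuous_iff_continuousAt.2 fun x ↦ (hφ x).continuousAt) fun x ↦ ?_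
  obtain ⟨d, c, hx, hc⟩ := SliceChart.exists_isAdapted (hφ x)
  exact ⟨c.source, c.open_source.mem_nhds hx, c.secondCountableTopology_source, hc.injOn⟩

/-! ### The space of slice germs -/

variable (𝕜 E C F M₀) in
/-- A germ of a slice of `M₀`, encoded as a point of `M₀` together with the filter of neighbourhoods
of that point within the slice. -/
@[ext]
structure SliceGerm where
  pt : M₀
  nhds : Filter M₀
  exists_slice : ∃ d : SliceChart 𝕜 E C F M₀, pt ∈ d.slice ∧ nhds = 𝓝[d.slice] pt

namespace SliceGerm

/-- The germ of a slice at one of its points. -/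
def ofSlice (d : SliceChart 𝕜 E C F M₀) {q : M₀} (hq : q ∈ d.slice) : SliceGerm 𝕜 E C F M₀ :=
  ⟨q, 𝓝[d.slice] q, d, hq, rfl⟩

open Classical in
/-- The coordinate of a slice, on the germs of this slice. The inverse takes the germ at the base
point as a default value. -/
noncomputable def coordEquiv (d : SliceChart 𝕜 E C F M₀) :
    PartialEquiv (SliceGerm 𝕜 E C F M₀) E where
  toFun g := d.coord g.pt
  invFun v := if hv : v ∈ d.dom then ofSlice d (d.param_mem_slice hv)
    else ofSlice d (d.param_mem_slice d.base_mem)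
  source := {g | g.pt ∈ d.slice ∧ g.nhds = 𝓝[d.slice] g.pt}
  target := d.dom
  map_source' _ hg := d.coord_mem_dom hg.1
  map_target' v hv := by
    rw [dif_pos hv]
    exact ⟨d.param_mem_slice hv, rfl⟩
  left_inv' g hg := by
    rw [dif_pos (d.coord_mem_dom hg.1)]
    ext1
    · exact d.param_coord hg.1
    · simp only [ofSlice, d.param_coord hg.1, hg.2]
  right_inv' v hv := by
    rw [dif_pos hv]
    exact d.coord_param hv

theorem coordEquiv_symm_apply {d : SliceChart 𝕜 E C F M₀} {v : E} (hv : v ∈ d.dom) :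
    (coordEquiv d).symm v = ofSlice d (d.param_mem_slice hv) :=
  dif_pos hv

theorem mem_coordEquiv_symm_trans_source {d d' : SliceChart 𝕜 E C F M₀} {v : E} :
    v ∈ ((coordEquiv d).symm.trans (coordEquiv d')).source ↔
      v ∈ d.dom ∧ d.param v ∈ d'.slice ∧
        𝓝[d.slice] (d.param v) = 𝓝[d'.slice] (d.param v) := by
  rw [PartialEquiv.trans_source]
  refine and_congr_right fun hv ↦ ?_
  rw [mem_preimage, coordEquiv_symm_apply hv]
  rfl

theorem contDiffOn_coordEquiv_symm_trans (d d' : SliceChart 𝕜 E C F M₀) :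
    ContDiffOn 𝕜 ω ((coordEquiv d).symm.trans (coordEquiv d'))
      ((coordEquiv d).symm.trans (coordEquiv d')).source := by
  have heq : EqOn ((coordEquiv d).symm.trans (coordEquiv d')) (d'.coord ∘ d.param)
      ((coordEquiv d).symm.trans (coordEquiv d')).source := fun v hv ↦
    congrArg (coordEquiv d') (coordEquiv_symm_apply hv.1)
  refine ContDiffOn.congr (fun v hv ↦ ?_) heq
  obtain ⟨hdom, hslice, -⟩ := mem_coordEquiv_symm_trans_source.1 hv
  exact (d.contDiffAt_coord_param d' hdom hslice.1).contDiffWithinAt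

theorem isOpen_coordEquiv_symm_trans_source (d d' : SliceChart 𝕜 E C F M₀) :
    IsOpen ((coordEquiv d).symm.trans (coordEquiv d')).source := by
  refine isOpen_iff_mem_nhds.2 fun v hv ↦ ?_
  obtain ⟨hdom, -, heq⟩ := mem_coordEquiv_symm_trans_source.1 hv
  have hslices : ∀ᶠ q in 𝓝 (d.param v), d.slice =ᶠ[𝓝 q] d'.slice :=
    eventually_eventually_nhds.2 (nhdsWithin_eq_iff_eventuallyEq.1 heq)
  filter_upwards [(d.contMDiffAt_param hdom).continuousAt.eventually hslices,
    d.isOpen_dom.mem_nhds hdom] with w hw hwdom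
  exact mem_coordEquiv_symm_trans_source.2 ⟨hwdom,
    hw.mem_iff.self_of_nhds.1 (d.param_mem_slice hwdom), nhdsWithin_eq_iff_eventuallyEq.2 hw⟩

variable (𝕜 E C F M₀) in
/-- The atlas of the space of slice germs given by the coordinates of all slices. -/
noncomputable def chartedSpaceCore : ChartedSpaceCore E (SliceGerm 𝕜 E C F M₀) where
  atlas := range coordEquiv
  chartAt g := coordEquiv g.exists_slice.choose
  mem_chart_source g := g.exists_slice.choose_spec
  chart_mem_atlas _ := mem_range_self _
  open_source := by
    rintro _ _ ⟨d, rfl⟩ ⟨d', rfl⟩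
    exact isOpen_coordEquiv_symm_trans_source d d'
  continuousOn_toFun := by
    rintro _ _ ⟨d, rfl⟩ ⟨d', rfl⟩
    exact (contDiffOn_coordEquiv_symm_trans d d').continuousOn

noncomputable instance : TopologicalSpace (SliceGerm 𝕜 E C F M₀) :=
  (chartedSpaceCore 𝕜 E C F M₀).toTopologicalSpace

noncomputable instance : ChartedSpace E (SliceGerm 𝕜 E C F M₀) :=
  (chartedSpaceCore 𝕜 E C F M₀).toChartedSpace

/-- The chart of the space of slice germs given by the coordinate of a slice. -/
noncomputable def coordChart (d : SliceChart 𝕜 E C F M₀) :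
    OpenPartialHomeomorph (SliceGerm 𝕜 E C F M₀) E :=
  (chartedSpaceCore 𝕜 E C F M₀).openPartialHomeomorph (coordEquiv d) (mem_range_self d)

theorem mem_coordChart_source {d : SliceChart 𝕜 E C F M₀} {g : SliceGerm 𝕜 E C F M₀} :
    g ∈ (coordChart d).source ↔ g.pt ∈ d.slice ∧ g.nhds = 𝓝[d.slice] g.pt := Iff.rfl

theorem exists_mem_coordChart_source (g : SliceGerm 𝕜 E C F M₀) :
    ∃ d, g ∈ (coordChart d).source := g.exists_slice

theorem exists_eq_coordChart {c : OpenPartialHomeomorph (SliceGerm 𝕜 E C F M₀) E}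
    (hc : c ∈ atlas E (SliceGerm 𝕜 E C F M₀)) : ∃ d, c = coordChart d := by
  change c ∈ ⋃ (e) (he : e ∈ (chartedSpaceCore 𝕜 E C F M₀).atlas),
    {(chartedSpaceCore 𝕜 E C F M₀).openPartialHomeomorph e he} at hc
  simp only [mem_iUnion, mem_singleton_iff] at hc
  obtain ⟨_, ⟨d, rfl⟩, h⟩ := hc
  exact ⟨d, h⟩

instance : IsManifold 𝓘(𝕜, E) ω (SliceGerm 𝕜 E C F M₀) := by
  refine isManifold_of_contDiffOn _ _ _ fun c c' hc hc' ↦ ?_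
  obtain ⟨d, rfl⟩ := exists_eq_coordChart hc
  obtain ⟨d', rfl⟩ := exists_eq_coordChart hc'
  simpa using! contDiffOn_coordEquiv_symm_trans d d'

theorem isAdapted_coordChart (d : SliceChart 𝕜 E C F M₀) : d.IsAdapted (coordChart d) pt :=
  fun _ hg ↦ ⟨hg.1, rfl⟩

theorem map_pt_nhds (g : SliceGerm 𝕜 E C F M₀) : map pt (𝓝 g) = g.nhds := by
  obtain ⟨d, hd⟩ := g.exists_mem_coordChart_source
  rw [(isAdapted_coordChart d).map_nhds hd, hd.2]

theorem continuous_pt : Continuous (pt : SliceGerm 𝕜 E C F M₀ → M₀) := by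
  refine continuous_iff_continuousAt.2 fun g ↦ ?_
  obtain ⟨d, hd⟩ := g.exists_slice
  rw [ContinuousAt, Tendsto, map_pt_nhds, hd.2]
  exact nhdsWithin_le_nhds

theorem continuousAt_of_eventually_mem_coordChart_source {X : Type*} [TopologicalSpace X]
    {σ : X → SliceGerm 𝕜 E C F M₀} {x : X} (hσ : ContinuousAt (pt ∘ σ) x)
    {d : SliceChart 𝕜 E C F M₀} (hd : ∀ᶠ y in 𝓝 x, σ y ∈ (coordChart d).source) :
    ContinuousAt σ x :=
  ((coordChart d).continuousAt_iff_continuousAt_comp_left hd).2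
    (ContinuousAt.comp (f := pt ∘ σ) (g := d.coord)
      (d.contMDiffAt_coord hd.self_of_nhds.1.1).continuousAt hσ)

theorem eq_of_nhds_le [CompleteSpace 𝕜] [FiniteDimensional 𝕜 E] {g g' : SliceGerm 𝕜 E C F M₀}
    (hpt : g.pt = g'.pt) (hle : g.nhds ≤ g'.nhds) : g = g' := by
  obtain ⟨d, hd, hnhds⟩ := g.exists_slice
  obtain ⟨d', hd', hnhds'⟩ := g'.exists_slice
  refine SliceGerm.ext hpt ?_
  rw [hnhds, hnhds', ← hpt] at hle ⊢
  exact d.nhdsWithin_slice_eq_of_le d' hd (hpt ▸ hd') hle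

instance [CompleteSpace 𝕜] [FiniteDimensional 𝕜 E] [LocallyConnectedSpace E] [T2Space M₀] :
    T2Space (SliceGerm 𝕜 E C F M₀) := by
  refine t2_iff_nhds.2 fun {g g'} hne ↦ ?_
  have hpt : g.pt = g'.pt := tendsto_nhds_unique
    (continuous_pt.continuousAt.mono_left inf_le_left : Tendsto pt (𝓝 g ⊓ 𝓝 g') (𝓝 g.pt))
    (continuous_pt.continuousAt.mono_left inf_le_right)
  obtain ⟨d, hd⟩ := g.exists_mem_coordChart_source
  obtain ⟨d', hd'⟩ := g'.exists_mem_coordChart_source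
  have hfreq : ∃ᶠ a in 𝓝 g, a ∈ (coordChart d').source :=
    frequently_iff_neBot.2 <| hne.mono <| inf_le_inf_left _ <|
      le_principal_iff.2 ((coordChart d').open_source.mem_nhds hd')
  have hslices : ∃ᶠ q in 𝓝[d.slice] g.pt, 𝓝[d.slice] q ≤ 𝓝[d'.slice] q := by
    rw [← (isAdapted_coordChart d).map_nhds hd, frequently_map]
    refine (hfreq.and_eventually ((coordChart d).open_source.mem_nhds hd)).mono ?_
    rintro a ⟨ha', ha⟩
    exact (ha.2.symm.trans ha'.2).le
  refine eq_of_nhds_le hpt ?_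
  rw [hd.2, hd'.2, ← hpt]
  exact d.nhdsWithin_slice_le_of_frequently d' hd.1 (hpt ▸ hd'.1.1) hslices

section Lift

variable {X : Type*} [TopologicalSpace X] [ChartedSpace E X] {φ : X → M₀}

/-- The germs of the slices locally parametrized by an immersion `φ`. -/
def lift (hφ : Manifold.IsImmersionOfComplement C 𝓘(𝕜, E) 𝓘(𝕜, F) ω φ) (x : X) :
    SliceGerm 𝕜 E C F M₀ where
  pt := φ x
  nhds := map φ (𝓝 x)
  exists_slice := by
    obtain ⟨d, c, hx, hc⟩ := SliceChart.exists_isAdapted (hφ x)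
    exact ⟨d, (hc x hx).1, hc.map_nhds hx⟩

variable (hφ : Manifold.IsImmersionOfComplement C 𝓘(𝕜, E) 𝓘(𝕜, F) ω φ)

theorem continuous_lift : Continuous (lift hφ) := by
  refine continuous_iff_continuousAt.2 fun x ↦ ?_
  obtain ⟨d, c, hx, hc⟩ := SliceChart.exists_isAdapted (hφ x)
  refine continuousAt_of_eventually_mem_coordChart_source (d := d) (hφ x).continuousAt ?_
  filter_upwards [c.open_source.mem_nhds hx] with y hy
  exact mem_coordChart_source.2 ⟨(hc y hy).1, hc.map_nhds hy⟩

variable [CompleteSpace 𝕜] [FiniteDimensional 𝕜 E]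

theorem lift_eq_of_eventually_mem_slice {d : SliceChart 𝕜 E C F M₀} {x : X}
    (hd : ∀ᶠ y in 𝓝 x, φ y ∈ d.slice) : lift hφ x = ofSlice d hd.self_of_nhds :=
  eq_of_nhds_le rfl (tendsto_nhdsWithin_iff.2 ⟨(hφ x).continuousAt, hd⟩)

theorem eq_lift_of_continuous {ρ : X → SliceGerm 𝕜 E C F M₀} (hρ : Continuous ρ)
    (h : φ = pt ∘ ρ) : ρ = lift hφ := by
  funext x
  refine (eq_of_nhds_le (congrFun h x) ?_).symm
  calc map φ (𝓝 x) = map pt (map ρ (𝓝 x)) := by rw [h, map_map]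
    _ ≤ map pt (𝓝 (ρ x)) := map_mono hρ.continuousAt
    _ = (ρ x).nhds := map_pt_nhds (ρ x)

end Lift

/-! ### Leaves -/

section Baire

variable {X : Type*} [TopologicalSpace X] [ChartedSpace E X] {φ : X → M₀}
  [CompleteSpace 𝕜] [FiniteDimensional 𝕜 E] [ProperSpace E] [T2Space M₀]

theorem exists_lift_mem_of_image_subset
    (hφ : Manifold.IsImmersionOfComplement C 𝓘(𝕜, E) 𝓘(𝕜, F) ω φ) {A : Set (SliceGerm 𝕜 E C F M₀)}
    (hA : IsOpen A) (hAl : IsLindelof A) {U : Set X} (hU : IsOpen U) (hne : U.Nonempty)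
    (hsub : φ '' U ⊆ pt '' A) : ∃ x, lift hφ x ∈ A := by
  have := baireSpace_of_chartedSpace E X
  have := ChartedSpace.locallyCompactSpace E (SliceGerm 𝕜 E C F M₀)
  have hcont : Continuous φ := continuous_iff_continuousAt.2 fun x ↦ (hφ x).continuousAt
  choose d hd using exists_mem_coordChart_source (𝕜 := 𝕜) (E := E) (C := C) (F := F) (M₀ := M₀)
  choose! K hK hKsub hKc using fun a (ha : a ∈ A) ↦
    local_compact_nhds (inter_mem (hA.mem_nhds ha) ((coordChart (d a)).open_source.mem_nhds (hd a)))
  obtain ⟨T, hT, hAT⟩ := hAl.elim_nhds_subcover' (fun a _ ↦ K a) hK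
  have := hT.to_subtype
  have hcover : U ⊆ ⋃ a : T, φ ⁻¹' (pt '' K a) := by
    intro x hx
    obtain ⟨b, hb, hbx⟩ := hsub (mem_image_of_mem φ hx)
    obtain ⟨a, ha, hba⟩ := mem_iUnion₂.1 (hAT hb)
    exact mem_iUnion.2 ⟨⟨a, ha⟩, b, hba, hbx⟩
  obtain ⟨⟨⟨a, ha⟩, _⟩, x, hx⟩ := exists_nonempty_interior_of_subset_iUnion hU hne
    (fun a ↦ ((hKc _ a.1.2).image continuous_pt).isClosed.preimage hcont) hcover
  obtain ⟨b, hbK, hbx⟩ : x ∈ φ ⁻¹' (pt '' K a) := interior_subset hx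
  have hslice : ∀ᶠ y in 𝓝 x, φ y ∈ (d a).slice := by
    filter_upwards [mem_interior_iff_mem_nhds.1 hx] with y hy
    obtain ⟨b', hb'K, hb'⟩ := hy
    exact hb' ▸ (hKsub a ha hb'K).2.1
  have hlift : lift hφ x = b := by
    refine (lift_eq_of_eventually_mem_slice hφ hslice).trans (SliceGerm.ext hbx.symm ?_)
    rw [(hKsub a ha hbK).2.2, hbx]
    rfl
  exact ⟨x, hlift ▸ (hKsub a ha hbK).1⟩

end Baire

section Leaf

variable [LocallyConnectedSpace E]

instance : LocallyConnectedSpace (SliceGerm 𝕜 E C F M₀) := ChartedSpace.locallyConnectedSpace E _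

/-- The leaf through a germ: its connected component in the space of slice germs. -/
def leaf (g : SliceGerm 𝕜 E C F M₀) : TopologicalSpace.Opens (SliceGerm 𝕜 E C F M₀) :=
  ⟨connectedComponent g, isOpen_connectedComponent⟩

instance (g : SliceGerm 𝕜 E C F M₀) : ConnectedSpace (leaf g) :=
  isConnected_iff_connectedSpace.1 isConnected_connectedComponent

/-- The immersion of a leaf into the ambient manifold. -/
def leafMap (g : SliceGerm 𝕜 E C F M₀) (a : leaf g) : M₀ := a.1.pt

variable {g : SliceGerm 𝕜 E C F M₀}

theorem apply_mem_leaf {X : Type*} [TopologicalSpace X] [PreconnectedSpace X]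
    {σ : X → SliceGerm 𝕜 E C F M₀} (hσ : Continuous σ) {x : X} (hx : σ x ∈ leaf g) (y : X) :
    σ y ∈ leaf g := by
  have hy : σ y ∈ connectedComponent (σ x) :=
    (isPreconnected_range hσ).subset_connectedComponent (mem_range_self x) (mem_range_self y)
  rwa [← connectedComponent_eq hx] at hy

theorem isImmersionOfComplement_leafMap :
    Manifold.IsImmersionOfComplement C 𝓘(𝕜, E) 𝓘(𝕜, F) ω (leafMap g) := by
  intro a
  obtain ⟨d, hd⟩ := exists_eq_coordChart (chart_mem_atlas E a.1)
  have hadapted : d.IsAdapted (chartAt E a) (leafMap g) := fun b hb ↦ by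
    rw [TopologicalSpace.Opens.chartAt_eq, hd] at hb ⊢
    exact isAdapted_coordChart d b.1 (by simpa using hb)
  exact hadapted.isImmersionAtOfComplement (IsManifold.chart_mem_maximalAtlas a)
    (mem_chart_source E a)

variable [CompleteSpace 𝕜] [FiniteDimensional 𝕜 E] [ProperSpace E] [T2Space M₀]
  [SecondCountableTopology M₀]

instance : SecondCountableTopology (leaf g) :=
  secondCountableTopology_of_isImmersionOfComplement isImmersionOfComplement_leafMap

theorem isLindelof_leaf : IsLindelof (leaf g : Set (SliceGerm 𝕜 E C F M₀)) :=
  isLindelof_iff_lindelofSpace.2 (inferInstanceAs (LindelofSpace (leaf g)))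

theorem existsUnique_contMDiff_leafMap_comp {M₁ : Type*} [TopologicalSpace M₁]
    [ChartedSpace E M₁] [PreconnectedSpace M₁]
    {φ₁ : M₁ → M₀} (hφ₁ : Manifold.IsImmersionOfComplement C 𝓘(𝕜, E) 𝓘(𝕜, F) ω φ₁)
    {U₁ : Set M₁} (hU₁ : IsOpen U₁) (hne : U₁.Nonempty) (hsub : φ₁ '' U₁ ⊆ range (leafMap g)) :
    ∃! ρ : M₁ → leaf g, ContMDiff 𝓘(𝕜, E) 𝓘(𝕜, E) ω ρ ∧ φ₁ = leafMap g ∘ ρ := by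
  have hrange : range (leafMap g) ⊆ pt '' (leaf g : Set (SliceGerm 𝕜 E C F M₀)) := by
    rintro _ ⟨a, rfl⟩
    exact ⟨a, a.2, rfl⟩
  obtain ⟨x, hx⟩ := exists_lift_mem_of_image_subset hφ₁ (leaf g).isOpen isLindelof_leaf hU₁ hne
    (hsub.trans hrange)
  have hmem (y : M₁) : lift hφ₁ y ∈ leaf g :=
    apply_mem_leaf (continuous_lift hφ₁) hx y
  refine ⟨fun y ↦ ⟨lift hφ₁ y, hmem y⟩, ⟨?_, rfl⟩, ?_⟩
  · exact (ContMDiff.iff_comp_isImmersionOfComplement isImmersionOfComplement_leafMap).2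
      ⟨(continuous_lift hφ₁).subtype_mk _, hφ₁.contMDiff⟩
  · rintro ρ ⟨hρ, hcomp⟩
    have hlift := eq_lift_of_continuous hφ₁ (continuous_subtype_val.comp hρ.continuous) hcomp
    exact funext fun y ↦ Subtype.ext (congrFun hlift y)

end Leaf

end SliceGerm

/-! ### Leaf extensions -/

variable (𝕜 E C F) in
/-- Analytic submanifolds of `M₀`, not necessarily closed, with tangent spaces modelled on `E` and
normal spaces modelled on `C`. -/
def IsAnalyticSubmanifold (S : Set M₀) : Prop :=
  ∀ p ∈ S, ∃ d : SliceChart 𝕜 E C F M₀, p ∈ d.slice ∧ d.chart.source ∩ S = d.slice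

namespace IsAnalyticSubmanifold

variable {S : Set M₀}

/-- The germ of a submanifold at one of its points. -/
def germ (hS : IsAnalyticSubmanifold 𝕜 E C F S) (p : S) : SliceGerm 𝕜 E C F M₀ where
  pt := p
  nhds := 𝓝[S] p
  exists_slice := by
    obtain ⟨d, hp, hd⟩ := hS p p.2
    refine ⟨d, hp, ?_⟩
    rw [← hd, nhdsWithin_inter_of_mem
      (mem_nhdsWithin_of_mem_nhds (d.chart.open_source.mem_nhds hp.1))]

theorem continuous_germ (hS : IsAnalyticSubmanifold 𝕜 E C F S) : Continuous hS.germ := by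
  refine continuous_iff_continuousAt.2 fun p ↦ ?_
  obtain ⟨d, hp, hd⟩ := hS p p.2
  refine SliceGerm.continuousAt_of_eventually_mem_coordChart_source (d := d)
    continuous_subtype_val.continuousAt ?_
  filter_upwards [(d.chart.open_source.preimage continuous_subtype_val).mem_nhds hp.1] with q hq
  refine SliceGerm.mem_coordChart_source.2 ⟨hd ▸ ⟨hq, q.2⟩, ?_⟩
  change 𝓝[S] q.1 = 𝓝[d.slice] q.1
  rw [← hd, nhdsWithin_inter_of_mem
    (mem_nhdsWithin_of_mem_nhds (d.chart.open_source.mem_nhds hq))]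

end IsAnalyticSubmanifold

variable (𝕜 E C F) in
/-- `(M, φ)` is a leaf extension of the submanifold `S` of `M₀` in the category of analytic
manifolds over `𝕜`, where a test manifold is any connected space with an analytic atlas. -/
structure IsAnalyticLeafExtension (S : Set M₀) (M : Type v) [TopologicalSpace M] [ChartedSpace E M]
    (φ : M → M₀) : Prop where
  t2 : T2Space M
  secondCountable : SecondCountableTopology M
  isManifold : IsManifold 𝓘(𝕜, E) ω M
  connected : ConnectedSpace M
  isImmersion : Manifold.IsImmersionOfComplement C 𝓘(𝕜, E) 𝓘(𝕜, F) ω φ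
  subset_range : S ⊆ range φ
  universal : ∀ (M₁ : Type w) [TopologicalSpace M₁] [ChartedSpace E M₁] [IsManifold 𝓘(𝕜, E) ω M₁]
    [ConnectedSpace M₁] (φ₁ : M₁ → M₀),
    Manifold.IsImmersionOfComplement C 𝓘(𝕜, E) 𝓘(𝕜, F) ω φ₁ →
      (∃ U₁ : Set M₁, IsOpen U₁ ∧ U₁.Nonempty ∧ φ₁ '' U₁ ⊆ range φ) →
      ∃! ρ : M₁ → M, ContMDiff 𝓘(𝕜, E) 𝓘(𝕜, E) ω ρ ∧ φ₁ = φ ∘ ρ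

theorem theorem1p2_general {𝕜 E C F : Type*} [RCLike 𝕜] [NormedAddCommGroup E] [NormedSpace 𝕜 E]
    [FiniteDimensional 𝕜 E] [NormedAddCommGroup C] [NormedSpace 𝕜 C] [NormedAddCommGroup F]
    [NormedSpace 𝕜 F] {M₀ : Type u} [TopologicalSpace M₀] [ChartedSpace F M₀] [T2Space M₀]
    [SecondCountableTopology M₀] [IsManifold 𝓘(𝕜, F) ω M₀] {S : Set M₀}
    (hS : IsAnalyticSubmanifold 𝕜 E C F S) (hS_conn : IsConnected S) :
    ∃ (M : Type u) (_ : TopologicalSpace M) (_ : ChartedSpace E M) (φ : M → M₀),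
      IsAnalyticLeafExtension.{u, u, w} 𝕜 E C F S M φ := by
  have := FiniteDimensional.proper_rclike 𝕜 E
  have : LocallyConnectedSpace E :=
    let _ := NormedSpace.restrictScalars ℝ 𝕜 E
    inferInstance
  have := isPreconnected_iff_preconnectedSpace.1 hS_conn.isPreconnected
  obtain ⟨p, hp⟩ := hS_conn.nonempty
  let g := hS.germ ⟨p, hp⟩
  refine ⟨SliceGerm.leaf g, inferInstance, inferInstance, SliceGerm.leafMap g, inferInstance,
    inferInstance, inferInstance, inferInstance, SliceGerm.isImmersionOfComplement_leafMap,
    fun q hq ↦ ⟨⟨hS.germ ⟨q, hq⟩, ?_⟩, rfl⟩, ?_⟩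
  · exact SliceGerm.apply_mem_leaf hS.continuous_germ
      (mem_connectedComponent : g ∈ SliceGerm.leaf g) _
  · rintro M₁ _ _ _ _ φ₁ hφ₁ ⟨U₁, hU₁, hne, hsub⟩
    exact SliceGerm.existsUnique_contMDiff_leafMap_comp hφ₁ hU₁ hne hsub

section Complex

variable {N n : ℕ} {M₀ : Type u} [TopologicalSpace M₀] [ChartedSpace (CSpace N) M₀]

theorem IsHolomorphicImmersion.isImmersionOfComplement {M : Type*} [TopologicalSpace M]
    [ChartedSpace (CSpace n) M] {φ : M → M₀} (h : IsHolomorphicImmersion n N φ) :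
    Manifold.IsImmersionOfComplement (CSpace (N - n)) 𝓘(ℂ, CSpace n) 𝓘(ℂ, CSpace N) ω φ := by
  obtain ⟨C, _, _, hC⟩ := h
  intro x
  let e : (CSpace n × C) ≃L[ℂ] CSpace N := (hC x).equiv
  have : FiniteDimensional ℂ (CSpace n × C) := e.symm.toLinearEquiv.finiteDimensional
  have : FiniteDimensional ℂ C := .of_surjective (LinearMap.snd ℂ (CSpace n) C)
    LinearMap.snd_surjective
  have hrank : n + Module.finrank ℂ C = N := by
    simpa using e.toLinearEquiv.finrank_eq
  exact (hC x).trans_F (.ofFinrankEq (by rw [finrank_euclideanSpace_fin]; omega))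

theorem exists_continuousLinearEquiv_mem_iff_snd_eq_zero {L : Submodule ℂ (CSpace N)}
    (hL : Module.finrank ℂ L = n) :
    ∃ e : (CSpace n × CSpace (N - n)) ≃L[ℂ] CSpace N, ∀ z, z ∈ L ↔ (e.symm z).2 = 0 := by
  obtain ⟨L', hL'⟩ := L.exists_isCompl
  have hrank : Module.finrank ℂ L + Module.finrank ℂ L' = N := by
    simpa using Submodule.finrank_add_eq_of_isCompl hL'
  let a : CSpace n ≃ₗ[ℂ] L := .ofFinrankEq _ _ (by simp [hL])
  let b : CSpace (N - n) ≃ₗ[ℂ] L' := .ofFinrankEq _ _ (by rw [finrank_euclideanSpace_fin]; omega)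
  refine ⟨((a.prodCongr b).trans (L.prodEquivOfIsCompl L' hL')).toContinuousLinearEquiv,
    fun z ↦ ?_⟩
  exact (L.prodEquivOfIsCompl_symm_apply_snd_eq_zero L' hL').symm.trans
    (map_eq_zero_iff b.symm b.symm.injective).symm

theorem IsComplexSubmanifold.isAnalyticSubmanifold {S : Set M₀}
    (hS : IsComplexSubmanifold N n S) :
    IsAnalyticSubmanifold ℂ (CSpace n) (CSpace (N - n)) (CSpace N) S := by
  intro p hp
  obtain ⟨e, he, hpe, L, hL, hSL⟩ := hS p hp
  obtain ⟨s, hs⟩ := exists_continuousLinearEquiv_mem_iff_snd_eq_zero hL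
  have hmem (q : M₀) (hq : q ∈ e.source) : q ∈ S ↔ (s.symm (e q)).2 = 0 :=
    (hSL q hq).trans (hs (e q))
  have hbase : s ((s.symm (e p)).1, 0) = e p := by
    rw [← (hmem p hpe).1 hp]
    exact s.apply_symm_apply _
  exact ⟨⟨e, he, s, (s.symm (e p)).1, hbase.symm ▸ e.map_source hpe⟩, ⟨hpe, (hmem p hpe).1 hp⟩,
    Set.ext fun q ↦ and_congr_right fun hq ↦ hmem q hq⟩

theorem IsAnalyticLeafExtension.isLeafExtension {S : Set M₀} {M : Type v} [TopologicalSpace M]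
    [ChartedSpace (CSpace n) M] {φ : M → M₀}
    (h : IsAnalyticLeafExtension.{u, v, w} ℂ (CSpace n) (CSpace (N - n)) (CSpace N) S M φ) :
    IsLeafExtension.{u, v, w} N n S M φ where
  subset_range := h.subset_range
  isLeafPair.isComplexManifold := ⟨h.t2, h.secondCountable, h.isManifold⟩
  isLeafPair.connected := h.connected
  isLeafPair.isImmersion := h.isImmersion.isImmersion
  isLeafPair.universal M₁ _ _ hM₁ _ φ₁ hφ₁ :=
    have := hM₁.isManifold
    h.universal M₁ φ₁ hφ₁.isImmersionOfComplement

end Complex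

theorem theorem1p2 (N n : ℕ) (M₀ : Type u) [TopologicalSpace M₀] [ChartedSpace (CSpace N) M₀]
    (hM₀ : IsComplexManifold N M₀) (S : Set M₀) (hS : IsComplexSubmanifold N n S)
    (hS_conn : IsConnected S) :
    ∃ (M : Type u) (_ : TopologicalSpace M) (_ : ChartedSpace (CSpace n) M) (φ : M → M₀),
      IsLeafExtension.{u, u, w} N n S M φ := by
  have ⟨_, _, _⟩ := hM₀
  obtain ⟨M, _, _, φ, hφ⟩ := theorem1p2_general hS.isAnalyticSubmanifold hS_conn
  exact ⟨M, _, _, φ, hφ.isLeafExtension⟩
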